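/- Let $p\in\mathbb{C}\setminus\{0\}$, $k,m\in\{0,1,2\}$ and $\zeta=e^{2\pi i/3}$. Let $E=[E_{i_1i_2i_3}]_{i_1,i_2,i_3=1}^3$ be the array with $$E_{123}=1,\quad E_{132}=p,\quad E_{213}=p\zeta^{k},\quad E_{231}=\zeta^{m},\quad E_{312}=\zeta^{-m},\quad E_{321}=p\zeta^{-k},$$ and all other entries equal to $0$. Let $C(A_{p,k,m}(3))$ be the universal unital C$^*$-algebra generated by the entries of a $3\times3$ matrix $u=[u_{jk}]$ subject to the unitarity condition $$\sum_{s=1}^3u_{js}u_{ks}^*=\delta_{jk}1=\sum_{s=1}^3u_{sj}^*u_{sk}\qquad(j,k=1,2,3)$$ and the twisted determinant condition $$\sum_{i_1,i_2,i_3=1}^3E_{i_1i_2i_3}\,u_{a_1i_1}u_{a_2i_2}u_{a_3i_3}=E_{a_1a_2a_3}\,1\qquad(a_1,a_2,a_3=1,2,3).$$ The pair $A_{p,k,m}(3)=(C(A_{p,k,m}(3)),u)$ is a compact quantum group, and it is called non-trivial if its C$^*$-algebra $C(A_{p,k,m}(3))$ is non-commutative. **Corollary.** The quantum group $A_{p,k,m}(3)$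 is non-trivial in each of the following cases: 1. $k+m\not\equiv 0 \pmod 3$ and $k\neq m$; 2. $m\neq 0$ and $k\equiv -m \pmod 3$; 3. $k=m=0$, $|p|=1$ and $p\in\mathbb{C}\setminus\mathbb{R}$. -/

import Mathlib

open scoped ENNReal CStarAlgebra

noncomputable section

namespace Woronowicz

/-- The relations of the Woronowicz construction in dimension `3` for an array `E`: the matrix `u`
over the unital C*-algebra `B` is unitary and satisfies the twisted determinant condition. -/
structure Relations (E : Fin 3 → Fin 3 → Fin 3 → ℂ) {B : Type*} [CStarAlgebra B]
    (u : Matrix (Fin 3) (Fin 3) B) : Prop where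
  row : ∀ j k, ∑ s, u j s * star (u k s) = if j = k then 1 else 0
  col : ∀ j k, ∑ s, star (u s j) * u s k = if j = k then 1 else 0
  det : ∀ a₁ a₂ a₃, ∑ i₁, ∑ i₂, ∑ i₃, E i₁ i₂ i₃ • (u a₁ i₁ * u a₂ i₂ * u a₃ i₃) =
    E a₁ a₂ a₃ • (1 : B)

theorem Relations.norm_le_one {E : Fin 3 → Fin 3 → Fin 3 → ℂ} {B : Type*} [CStarAlgebra B]
    [Nontrivial B] {u : Matrix (Fin 3) (Fin 3) B} (h : Relations E u) (i j : Fin 3) :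
    ‖u i j‖ ≤ 1 := by
  let _ := CStarAlgebra.spectralOrder B
  have _ := CStarAlgebra.spectralOrderedRing B
  have h1 : star (u i j) * u i j ≤ 1 := by
    have h2 := h.col j j
    rw [if_pos rfl] at h2
    rw [← h2]
    exact Finset.single_le_sum (f := fun s => star (u s j) * u s j)
      (fun s _ => star_mul_self_nonneg (u s j)) (Finset.mem_univ i)
  have h3 := CStarAlgebra.norm_le_norm_of_nonneg_of_le (star_mul_self_nonneg (u i j)) h1
  rw [CStarRing.norm_star_mul_self, norm_one] at h3
  nlinarith [norm_nonneg (u i j)]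

/-- A realization of the relations for `E` in some non-zero unital C*-algebra.  Only the
C*-subalgebra generated by the nine entries of `u` matters below; it is separable, hence of at most
continuum cardinality, so that carriers in `Type` represent all realizations. -/
structure Realization (E : Fin 3 → Fin 3 → Fin 3 → ℂ) : Type 1 where
  carrier : Type
  [cstar : CStarAlgebra carrier]
  [nontriv : Nontrivial carrier]
  u : Matrix (Fin 3) (Fin 3) carrier
  rel : Relations E u

instance (E : Fin 3 → Fin 3 → Fin 3 → ℂ) (R : Realization E) : CStarAlgebra R.carrier := R.cstar

instance (E : Fin 3 → Fin 3 → Fin 3 → ℂ) (R : Realization E) : Nontrivial R.carrier := R.nontriv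

instance {I : Type*} (B : I → Type*) [∀ i, CStarAlgebra (B i)] [∀ i, Nontrivial (B i)] :
    CStarAlgebra (lp B ∞) where
  toNormedRing := lp.inftyNormedRing
  toStarRing := lp.inftyStarRing
  toCompleteSpace := lp.completeSpace
  toCStarRing := lp.inftyCStarRing
  toNormedAlgebra := lp.inftyNormedAlgebra
  toStarModule := inferInstance

/-- The C*-algebra of bounded families indexed by all realizations of the relations for `E`. -/
abbrev BigProduct (E : Fin 3 → Fin 3 → Fin 3 → ℂ) : Type 1 :=
  lp (fun R : Realization E => R.carrier) ∞

/-- The matrix over the product whose `R`-component is the matrix of the realization `R`. -/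
def bigU (E : Fin 3 → Fin 3 → Fin 3 → ℂ) : Matrix (Fin 3) (Fin 3) (BigProduct E) := fun i j =>
  ⟨fun R => R.u i j, memℓp_infty ⟨1, by rintro _ ⟨R, rfl⟩; exact R.rel.norm_le_one i j⟩⟩

/-- The C*-subalgebra of the product generated by the entries of `bigU E`. -/
def subalgebra (E : Fin 3 → Fin 3 → Fin 3 → ℂ) : StarSubalgebra ℂ (BigProduct E) :=
  (StarAlgebra.adjoin ℂ {x | ∃ i j, x = bigU E i j}).topologicalClosure

instance (E : Fin 3 → Fin 3 → Fin 3 → ℂ) : IsClosed (subalgebra E : Set (BigProduct E)) :=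
  StarSubalgebra.isClosed_topologicalClosure _

/-- The universal unital C*-algebra generated by the entries of a `3 × 3` matrix subject to the
unitarity condition and the twisted determinant condition for `E`; see `relations_u`, `dense_u` and
`existsUnique_lift` for the properties that characterize it. -/
abbrev UniversalAlgebra (E : Fin 3 → Fin 3 → Fin 3 → ℂ) : Type 1 := subalgebra E

instance (E : Fin 3 → Fin 3 → Fin 3 → ℂ) : CStarAlgebra (UniversalAlgebra E) :=
  StarSubalgebra.cstarAlgebra (subalgebra E)

/-- The matrix of generators of the universal algebra (the fundamental corepresentation). -/
def u (E : Fin 3 → Fin 3 → Fin 3 → ℂ) : Matrix (Fin 3) (Fin 3) (UniversalAlgebra E) := fun i j =>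
  ⟨bigU E i j, StarSubalgebra.le_topologicalClosure _ (StarAlgebra.subset_adjoin _ _ ⟨i, j, rfl⟩)⟩

/-- Evaluation at a realization. -/
def eval (E : Fin 3 → Fin 3 → Fin 3 → ℂ) (R : Realization E) :
    UniversalAlgebra E →⋆ₐ[ℂ] R.carrier where
  toFun x := x.1.1 R
  map_one' := rfl
  map_mul' _ _ := rfl
  map_zero' := rfl
  map_add' _ _ := rfl
  commutes' _ := rfl
  map_star' _ := rfl

theorem eval_u (E : Fin 3 → Fin 3 → Fin 3 → ℂ) (R : Realization E) (i j : Fin 3) :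
    eval E R (u E i j) = R.u i j := rfl

theorem eval_star (E : Fin 3 → Fin 3 → Fin 3 → ℂ) (R : Realization E) (x : UniversalAlgebra E) :
    eval E R (star x) = star (eval E R x) := rfl

theorem ext_eval {E : Fin 3 → Fin 3 → Fin 3 → ℂ} {x y : UniversalAlgebra E}
    (h : ∀ R, eval E R x = eval E R y) : x = y :=
  Subtype.ext (lp.ext (funext h))

theorem relations_u (E : Fin 3 → Fin 3 → Fin 3 → ℂ) : Relations E (u E) where
  row j k := ext_eval fun R => by
    simpa [eval_u, eval_star, apply_ite (eval E R)] using R.rel.row j k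
  col j k := ext_eval fun R => by
    simpa [eval_u, eval_star, apply_ite (eval E R)] using R.rel.col j k
  det a₁ a₂ a₃ := ext_eval fun R => by
    simpa only [eval_u, map_sum, map_smul, map_mul, map_one] using R.rel.det a₁ a₂ a₃

theorem dense_u (E : Fin 3 → Fin 3 → Fin 3 → ℂ) :
    (StarAlgebra.adjoin ℂ {x | ∃ i j, x = u E i j}).topologicalClosure = ⊤ := by
  have h1 : (StarAlgebra.adjoin ℂ {x | ∃ i j, x = u E i j}).map (subalgebra E).subtype =
      StarAlgebra.adjoin ℂ {x | ∃ i j, x = bigU E i j} := by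
    rw [StarAlgHom.map_adjoin]
    congr 1
    ext x
    constructor
    · rintro ⟨_, ⟨i, j, rfl⟩, rfl⟩
      exact ⟨i, j, rfl⟩
    · rintro ⟨i, j, rfl⟩
      exact ⟨u E i j, ⟨i, j, rfl⟩, rfl⟩
  rw [eq_top_iff]
  rintro ⟨x, hx⟩ -
  have h2 : x ∈ closure (Subtype.val ''
      (StarAlgebra.adjoin ℂ {x | ∃ i j, x = u E i j} : Set (UniversalAlgebra E))) := by
    have h3 : (Subtype.val ''
        (StarAlgebra.adjoin ℂ {x | ∃ i j, x = u E i j} : Set (UniversalAlgebra E))) =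
        (StarAlgebra.adjoin ℂ {x | ∃ i j, x = bigU E i j} : Set (BigProduct E)) := by
      rw [← h1]; rfl
    rw [h3]
    exact hx
  exact closure_subtype.mpr h2

theorem existsUnique_lift (E : Fin 3 → Fin 3 → Fin 3 → ℂ) {B : Type} [CStarAlgebra B]
    (w : Matrix (Fin 3) (Fin 3) B) (hw : Relations E w) :
    ∃! φ : UniversalAlgebra E →⋆ₐ[ℂ] B, ∀ i j, φ (u E i j) = w i j := by
  have key : ∃ φ : UniversalAlgebra E →⋆ₐ[ℂ] B, ∀ i j, φ (u E i j) = w i j := by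
    rcases subsingleton_or_nontrivial B with hB | hB
    · exact ⟨{ toFun := fun _ => 0
               map_one' := Subsingleton.elim _ _
               map_mul' := fun _ _ => Subsingleton.elim _ _
               map_zero' := Subsingleton.elim _ _
               map_add' := fun _ _ => Subsingleton.elim _ _
               commutes' := fun _ => Subsingleton.elim _ _
               map_star' := fun _ => Subsingleton.elim _ _ }, fun _ _ => Subsingleton.elim _ _⟩
    · exact ⟨eval E ⟨B, w, hw⟩, fun _ _ => rfl⟩
  obtain ⟨φ, hφ⟩ := key
  refine ⟨φ, hφ, fun ψ hψ => ?_⟩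
  have hle : StarAlgebra.adjoin ℂ {x | ∃ i j, x = u E i j} ≤ StarAlgHom.equalizer ψ φ := by
    rw [StarAlgebra.adjoin_le_iff]
    rintro _ ⟨i, j, rfl⟩
    exact (hψ i j).trans (hφ i j).symm
  have hcl : IsClosed (StarAlgHom.equalizer ψ φ : Set (UniversalAlgebra E)) :=
    isClosed_eq (map_continuous ψ) (map_continuous φ)
  have htop := StarSubalgebra.topologicalClosure_minimal hle hcl
  rw [dense_u] at htop
  exact StarAlgHom.ext fun x => htop (Set.mem_univ x)

/-- The primitive cube root of unity `ζ = exp(2πi/3)`. -/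
def zeta : ℂ := Complex.exp (2 * Real.pi * Complex.I / 3)

/-- The array defining `A_{p,k,m}(3)`; the indices `1, 2, 3` are written `0, 1, 2`. -/
def arrayA (p : ℂ) (k m : ℕ) : Fin 3 → Fin 3 → Fin 3 → ℂ
  | 0, 1, 2 => 1
  | 0, 2, 1 => p
  | 1, 0, 2 => p * zeta ^ k
  | 1, 2, 0 => zeta ^ m
  | 2, 0, 1 => zeta ^ (-(m : ℤ))
  | 2, 1, 0 => p * zeta ^ (-(k : ℤ))
  | _, _, _ => 0

/-- The C*-algebra `C(A_{p,k,m}(3))`. -/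
abbrev AlgebraA (p : ℂ) (k m : ℕ) : Type 1 := UniversalAlgebra (arrayA p k m)

end Woronowicz

end

namespace Woronowicz

/-! By universality it suffices to realize the relations by one matrix with two non-commuting
entries. Take a monomial matrix, with a unitary `U i` at position `(i, σ i)` and zeros elsewhere.
Unitarity is then automatic, and since the array is supported on permutations, the determinant
condition only prescribes the six products of the `U i` in different orders. If the ratios `E a b e
/ E (σ a) (σ b) (σ e)` take one value `c` on even and one value `d` on odd permutations, both of
modulus one, such unitaries come from a Weyl pair `V W = (c/d) W V` on bilateral sequences
(`exists_unitary_triple`), and `c ≠ d` forces non-commutativity. A 3-cycle `σ` serves when `k ≠ m`,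
which covers the first two cases; a transposition serves the third. -/

/-- The bilateral sequence space. -/
abbrev SequenceSpace : Type := lp (fun _ : ℤ => ℂ) 2

/-- The standard Hilbert basis of the bilateral sequence space. -/
noncomputable def stdBasis : HilbertBasis ℤ ℂ SequenceSpace := HilbertBasis.ofRepr (LinearIsometryEquiv.refl ℂ _)

/-- A change of Hilbert basis is implemented by a unitary operator. -/
theorem exists_unitary_apply_basis (v : ℤ → SequenceSpace) (hv : Orthonormal ℂ v)
    (hspan : ∀ n, stdBasis n ∈ Submodule.span ℂ (Set.range v)) :
    ∃ V : SequenceSpace →L[ℂ] SequenceSpace, star V * V = 1 ∧ V * star V = 1 ∧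
      ∀ n, V (stdBasis n) = v n := by
  have htop : ⊤ ≤ (Submodule.span ℂ (Set.range v)).topologicalClosure := by
    rw [← stdBasis.dense_span]
    refine Submodule.topologicalClosure_mono (Submodule.span_le.mpr ?_)
    rintro _ ⟨n, rfl⟩
    exact hspan n
  let b := HilbertBasis.mk hv htop
  let e : SequenceSpace ≃ₗᵢ[ℂ] SequenceSpace := stdBasis.repr.trans b.repr.symm
  have hu := (Unitary.linearIsometryEquiv.symm e).2
  refine ⟨Unitary.linearIsometryEquiv.symm e, Unitary.star_mul_self_of_mem hu,
    Unitary.mul_star_self_of_mem hu, fun n => ?_⟩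
  have h1 : b n = v n := congrFun (HilbertBasis.coe_mk hv htop) n
  rw [← h1, ← b.repr_symm_single]
  change b.repr.symm (stdBasis.repr (stdBasis n)) = _
  rw [HilbertBasis.repr_self]

/-- Weyl's commutation relation is realized by unitary operators for every phase `q`. -/
theorem exists_weyl_pair (q : ℂ) (hq : ‖q‖ = 1) :
    ∃ V W : SequenceSpace →L[ℂ] SequenceSpace, star V * V = 1 ∧ V * star V = 1 ∧
      star W * W = 1 ∧ W * star W = 1 ∧ V * W = q • (W * V) := by
  have hq0 : q ≠ 0 := fun h => by simp [h] at hq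
  have hon := stdBasis.orthonormal
  -- `V` is the diagonal operator with entries `q ^ n` and `W` the shift. Infinite dimension allows
  -- any phase `q`, not just roots of unity.
  have h1 : Orthonormal ℂ fun n : ℤ => q ^ n • stdBasis n := by
    refine ⟨fun n => by simp [norm_smul, hq, hon.1 n], fun i j hij => ?_⟩
    simp only [inner_smul_left, inner_smul_right, hon.2 hij, mul_zero]
  obtain ⟨V, hV1, hV2, hV⟩ := exists_unitary_apply_basis _ h1 fun n => by
    have h2 := Submodule.smul_mem _ (q ^ n)⁻¹
      (Submodule.subset_span (R := ℂ) (Set.mem_range_self (f := fun n : ℤ => q ^ n • stdBasis n) n))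
    simpa [smul_smul, inv_mul_cancel₀ (zpow_ne_zero n hq0)] using h2
  obtain ⟨W, hW1, hW2, hW⟩ := exists_unitary_apply_basis (fun n => stdBasis (n + 1))
    (hon.comp _ (add_left_injective 1)) fun n =>
      Submodule.subset_span ⟨n - 1, by simp⟩
  refine ⟨V, W, hV1, hV2, hW1, hW2, ContinuousLinearMap.ext_on (s := Set.range stdBasis) ?_ ?_⟩
  · exact Submodule.dense_iff_topologicalClosure_eq_top.mpr stdBasis.dense_span
  · rintro _ ⟨n, rfl⟩
    simp [hV, hW, smul_smul, zpow_add₀ hq0, mul_comm]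

/-- Three unitaries whose products over even and odd permutations are prescribed phases. -/
theorem exists_unitary_triple (c d : ℂ) (hc : ‖c‖ = 1) (hd : ‖d‖ = 1) (hcd : c ≠ d) :
    ∃ U : Fin 3 → SequenceSpace →L[ℂ] SequenceSpace,
      (∀ i, star (U i) * U i = 1) ∧ (∀ i, U i * star (U i) = 1) ∧
      U 0 * U 1 * U 2 = c • 1 ∧ U 1 * U 2 * U 0 = c • 1 ∧ U 2 * U 0 * U 1 = c • 1 ∧
      U 0 * U 2 * U 1 = d • 1 ∧ U 2 * U 1 * U 0 = d • 1 ∧ U 1 * U 0 * U 2 = d • 1 ∧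
      U 1 * U 2 ≠ U 2 * U 1 := by
  have hd0 : d ≠ 0 := fun h => by simp [h] at hd
  obtain ⟨V, W, hV1, hV2, hW1, hW2, hVW⟩ := exists_weyl_pair (c / d) (by simp [hc, hd])
  have hWV : c • (W * V) = d • (V * W) := by
    rw [hVW, smul_smul, mul_div_cancel₀ _ hd0]
  have hcs : (starRingEnd ℂ) c * c = 1 := by
    rw [← Complex.normSq_eq_conj_mul_self]
    simp [Complex.normSq_eq_norm_sq, hc]
  have hcs' : c * (starRingEnd ℂ) c = 1 := by rw [mul_comm, hcs]
  have cV (x : SequenceSpace →L[ℂ] SequenceSpace) : star V * (V * x) = x := by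
    rw [← mul_assoc, hV1, one_mul]
  have cV' (x : SequenceSpace →L[ℂ] SequenceSpace) : V * (star V * x) = x := by
    rw [← mul_assoc, hV2, one_mul]
  have cW (x : SequenceSpace →L[ℂ] SequenceSpace) : star W * (W * x) = x := by
    rw [← mul_assoc, hW1, one_mul]
  have cW' (x : SequenceSpace →L[ℂ] SequenceSpace) : W * (star W * x) = x := by
    rw [← mul_assoc, hW2, one_mul]
  -- The first entry is forced by `U 1 * U 2 * U 0 = c • 1`. The even products are then
  -- cancellations; the odd ones use `hWV` to trade `c • (W * V)` for `d • (V * W)`.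
  refine ⟨![c • (star W * star V), V, W], ?_, ?_, ?_, ?_, ?_, ?_, ?_, ?_, ?_⟩
  · intro i
    fin_cases i
    · simp [mul_assoc, smul_smul, cW', hV2, hcs']
    · exact hV1
    · exact hW1
  · intro i
    fin_cases i
    · simp [mul_assoc, smul_smul, cV, hW1, hcs]
    · exact hV2
    · exact hW2
  · simp [mul_assoc, cV, hW1]
  · simp [mul_assoc, cW', hV2]
  · simp [cW', hV1]
  · have h1 : c • (star W * star V) * W * V = star W * star V * c • (W * V) := by
      simp [mul_assoc]
    simp only [Matrix.cons_val]
    rw [h1, hWV]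
    simp [mul_assoc, cV, hW1]
  · have h1 : W * V * c • (star W * star V) = c • (W * V) * (star W * star V) := by
      simp
    simp only [Matrix.cons_val]
    rw [h1, hWV]
    simp [mul_assoc, cW', hV2]
  · have h1 : V * c • (star W * star V) * W = star W * (c • (W * V) * (star W * star V)) * W := by
      simp [mul_assoc, cW]
    simp only [Matrix.cons_val]
    rw [h1, hWV]
    simp [mul_assoc, cW', cV', hW1]
  · intro h
    simp only [Matrix.cons_val] at h
    rw [h] at hWV
    -- `W * V` is invertible on a non-zero space, so it cannot vanish.
    have h1 : (c - d) • (W * V) = 0 := by rw [sub_smul, hWV, sub_self]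
    rcases smul_eq_zero.mp h1 with h2 | h2
    · exact hcd (sub_eq_zero.mp h2)
    · have h3 : star V * (star W * (W * V)) = 0 := by rw [h2]; simp
      rw [cW, hV1] at h3
      have h4 : stdBasis 0 = 0 := by
        simpa using congrArg (fun T : SequenceSpace →L[ℂ] SequenceSpace => T (stdBasis 0)) h3
      exact stdBasis.orthonormal.ne_zero 0 h4

theorem norm_zeta : ‖zeta‖ = 1 := by
  have h : zeta = Complex.exp ((2 * Real.pi / 3 : ℝ) * Complex.I) := by
    rw [zeta]; congr 1; push_cast; ring
  rw [h, Complex.norm_exp_ofReal_mul_I]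

theorem zeta_isPrimitiveRoot : IsPrimitiveRoot zeta 3 :=
  Complex.isPrimitiveRoot_exp 3 (by norm_num)

/-! ### Monomial realizations of the relations -/

/-- A monomial matrix of unitaries satisfies the relations as soon as the products of its entries
match the ratios of the entries of the array. -/
theorem relations_monomial {E : Fin 3 → Fin 3 → Fin 3 → ℂ} {B : Type*} [CStarAlgebra B]
    (σ : Equiv.Perm (Fin 3)) (U : Fin 3 → B) (h1 : ∀ i, star (U i) * U i = 1)
    (h2 : ∀ i, U i * star (U i) = 1)
    (h3 : ∀ a b c, E (σ a) (σ b) (σ c) • (U a * U b * U c) = E a b c • (1 : B)) :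
    Relations E (Matrix.of fun i j => if j = σ i then U i else 0) where
  row j k := by
    by_cases hjk : j = k
    · subst hjk
      simp [h2, apply_ite star]
    · simp [hjk, Ne.symm hjk, apply_ite star]
  col j k := by
    by_cases hjk : j = k
    · subst hjk
      simp [h1, apply_ite star, ← Equiv.symm_apply_eq]
    · have h4 : σ.symm k ≠ σ.symm j := fun h => hjk (σ.symm.injective h).symm
      simp [hjk, h4.symm, apply_ite star, ← Equiv.symm_apply_eq]
  det a b c := by
    simpa [Matrix.of_apply, mul_ite, ite_mul, Finset.sum_ite_eq'] using h3 a b c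

/-- A realization with two non-commuting entries makes the universal algebra non-commutative. -/
theorem exists_not_commute {E : Fin 3 → Fin 3 → Fin 3 → ℂ} {B : Type} [CStarAlgebra B]
    {w : Matrix (Fin 3) (Fin 3) B} (hw : Relations E w) {i j k l : Fin 3}
    (hne : w i j * w k l ≠ w k l * w i j) : ∃ x y : UniversalAlgebra E, x * y ≠ y * x := by
  obtain ⟨φ, hφ, -⟩ := existsUnique_lift E w hw
  refine ⟨u E i j, u E k l, fun h => hne ?_⟩
  simpa only [map_mul, hφ] using congrArg φ h

/-- Reduces non-commutativity to six scalar identities: the ratio of the array to its `σ`-permuted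
copy must depend only on the sign of the permutation. -/
theorem exists_not_commute_of_products {E : Fin 3 → Fin 3 → Fin 3 → ℂ} (σ : Equiv.Perm (Fin 3))
    (c d : ℂ) (hc : ‖c‖ = 1) (hd : ‖d‖ = 1) (hcd : c ≠ d)
    (hE : ∀ a b e, ¬ (a ≠ b ∧ b ≠ e ∧ a ≠ e) → E a b e = 0)
    (h012 : E (σ 0) (σ 1) (σ 2) * c = E 0 1 2) (h120 : E (σ 1) (σ 2) (σ 0) * c = E 1 2 0)
    (h201 : E (σ 2) (σ 0) (σ 1) * c = E 2 0 1) (h021 : E (σ 0) (σ 2) (σ 1) * d = E 0 2 1)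
    (h210 : E (σ 2) (σ 1) (σ 0) * d = E 2 1 0) (h102 : E (σ 1) (σ 0) (σ 2) * d = E 1 0 2) :
    ∃ x y : UniversalAlgebra E, x * y ≠ y * x := by
  obtain ⟨U, hU1, hU2, e1, e2, e3, e4, e5, e6, hne⟩ := exists_unitary_triple c d hc hd hcd
  refine exists_not_commute (relations_monomial σ U hU1 hU2 fun a b e => ?_)
    (i := 1) (j := σ 1) (k := 2) (l := σ 2) (by simpa using hne)
  by_cases hab : a ≠ b ∧ b ≠ e ∧ a ≠ e
  · revert hab
    fin_cases a <;> fin_cases b <;> fin_cases e <;>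
      simp [e1, e2, e3, e4, e5, e6, smul_smul, h012, h120, h201, h021, h210, h102]
  · rw [hE a b e hab, hE (σ a) (σ b) (σ e) (by simpa using hab), zero_smul, zero_smul]

theorem arrayA_eq_zero (p : ℂ) (k m : ℕ) (a b e : Fin 3) (h : ¬ (a ≠ b ∧ b ≠ e ∧ a ≠ e)) :
    arrayA p k m a b e = 0 := by
  revert h
  fin_cases a <;> fin_cases b <;> fin_cases e <;> simp [arrayA]

/-- Under the rotation `i ↦ i + 1` the ratios are `ζ ^ (-m)` on even and `ζ ^ (-k)` on odd
permutations, because `ζ ^ 3 = 1`. They differ since `k` and `m` are distinct exponents below 3. -/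
theorem exists_not_commute_of_ne (p : ℂ) (k m : ℕ) (hk : k ≤ 2) (hm : m ≤ 2) (hkm : k ≠ m) :
    ∃ x y : AlgebraA p k m, x * y ≠ y * x := by
  have hz := zeta_isPrimitiveRoot.pow_eq_one
  have hz0 := zeta_isPrimitiveRoot.ne_zero (by norm_num)
  have hthree (n : ℕ) : zeta ^ (-(n : ℤ)) * zeta ^ (-(n : ℤ)) = zeta ^ n := by
    have h1 : zeta ^ n * zeta ^ n * zeta ^ n = 1 := by
      rw [← pow_add, ← pow_add, show n + n + n = 3 * n by ring, pow_mul, hz, one_pow]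
    rw [zpow_neg, zpow_natCast]
    field_simp
    linear_combination -h1
  have hinv (n : ℕ) : zeta ^ n * zeta ^ (-(n : ℤ)) = 1 := by
    rw [zpow_neg, zpow_natCast, mul_inv_cancel₀ (pow_ne_zero n hz0)]
  refine exists_not_commute_of_products (finRotate 3) (zeta ^ (-(m : ℤ))) (zeta ^ (-(k : ℤ)))
    (by simp [norm_zeta]) (by simp [norm_zeta]) ?_ (arrayA_eq_zero p k m) ?_ ?_ ?_ ?_ ?_ ?_
  · intro h
    rw [zpow_neg, zpow_neg, inv_inj, zpow_natCast, zpow_natCast] at h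
    exact hkm (zeta_isPrimitiveRoot.pow_inj (by omega) (by omega) h.symm)
  · exact hinv m
  · exact hthree m
  · exact one_mul _
  · change p * zeta ^ k * zeta ^ (-(k : ℤ)) = p
    rw [mul_assoc, hinv, mul_one]
  · rfl
  · change p * zeta ^ (-(k : ℤ)) * zeta ^ (-(k : ℤ)) = p * zeta ^ k
    rw [mul_assoc, hthree]

/-- Swapping two indices exchanges the values `1` and `p`, so the ratios are `p⁻¹` and `p`. These
coincide only for `p = ±1`, which is real. -/
theorem exists_not_commute_of_norm_eq_one (p : ℂ) (hp : ‖p‖ = 1)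
    (hpr : p ∉ Set.range ((↑) : ℝ → ℂ)) : ∃ x y : AlgebraA p 0 0, x * y ≠ y * x := by
  have hp0 : p ≠ 0 := fun h => by simp [h] at hp
  refine exists_not_commute_of_products (Equiv.swap 0 1) p⁻¹ p (by simp [hp]) hp ?_
    (arrayA_eq_zero p 0 0) ?_ ?_ ?_ ?_ ?_ ?_
  · intro h
    have h1 : p * p = 1 := by
      nth_rewrite 1 [← h]
      exact inv_mul_cancel₀ hp0
    rcases mul_self_eq_one_iff.mp h1 with h2 | h2
    · exact hpr ⟨1, by simp [h2]⟩
    · exact hpr ⟨-1, by simp [h2]⟩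
  all_goals simp [Equiv.swap_apply_def, arrayA, hp0]

end Woronowicz

theorem mainTheorem11 (p : ℂ) (hp : p ≠ 0) (k m : ℕ) (hk : k ≤ 2) (hm : m ≤ 2)
    (h : (¬ 3 ∣ k + m ∧ k ≠ m) ∨
      (m ≠ 0 ∧ (k : ℤ) ≡ -(m : ℤ) [ZMOD 3]) ∨
      (k = 0 ∧ m = 0 ∧ ‖p‖ = 1 ∧ p ∉ Set.range ((↑) : ℝ → ℂ))) :
    ∃ x y : Woronowicz.AlgebraA p k m, x * y ≠ y * x := by
  rcases h with ⟨-, hkm⟩ | ⟨hm0, hkm⟩ | ⟨rfl, rfl, hp1, hpr⟩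
  · exact Woronowicz.exists_not_commute_of_ne p k m hk hm hkm
  · refine Woronowicz.exists_not_commute_of_ne p k m hk hm fun h => ?_
    -- If `k = m`, this says that 3 divides `2 * m`, impossible for `m` equal to 1 or 2.
    have h1 : (3 : ℤ) ∣ -(m : ℤ) - k := hkm.dvd
    omega
  · exact Woronowicz.exists_not_commute_of_norm_eq_one p hp1 hpr
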